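/- Let $G$ be an Abelian group (regarded as discrete) and let $\widehat G$ be its dual group: the compact group of characters, i.e. homomorphisms $\gamma\colon G\to S^1=\{z\in\mathbb C:|z|=1\}$, with the topology of pointwise convergence. For a set $\Gamma\subset\widehat G$ and $\delta\in(0,2]$ put $$\mathrm{Bohr}(\Gamma,\delta):=\{x\in G:|\gamma(x)-1|\le\delta\text{ for all }\gamma\in\Gamma\}.$$ A finite non-empty set $X\subset G$ has relative polynomial growth of order $d$ if $|nX|\le n^d|X|$ for every integer $n\ge1$, where $nX=\{x_1+\dots+x_n:x_1,\dots,x_n\in X\}$. There is an absolute constant $C>0$ such that the following holds. Let $d\ge1$ be real, and suppose that a finite non-empty subset $X$ of an Abelian group $G$ has relative polynomial growth of order $d$. Then there are a neighbourhood $\Gamma$ of the trivial character in $\widehat G$ and a natural number $k\le C\,d\log^2(2+d)$ such that $$X-X\subset\mathrm{Bohr}\Bigl(\Gamma,\tfrac1{4(3k+1)}\Bigr),$$ and $\mathrm{Bohr}(\Gamma,1/2)$ is finite with $|\mathrm{Bohr}(\Gamma,1/2)|<2^k|X|$. -/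

import Mathlib

open scoped Pointwise Topology

namespace RelGrowth

/-- The `n`-fold sumset `nX = X + ⋯ + X = {x₁ + ⋯ + xₙ : x₁, …, xₙ ∈ X}`. -/
def iterSumset {G : Type*} [AddCommGroup G] (n : ℕ) (X : Set G) : Set G :=
  {g | ∃ x : Fin n → G, (∀ i, x i ∈ X) ∧ ∑ i, x i = g}

/-- A (finite, non-empty) set `X` has relative polynomial growth of order `d` if
`|nX| ≤ n ^ d |X|` for all positive integers `n`. -/
def HasRelPolyGrowth {G : Type*} [AddCommGroup G] (X : Set G) (d : ℝ) : Prop :=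
  ∀ n : ℕ, 1 ≤ n → ((iterSumset n X).ncard : ℝ) ≤ (n : ℝ) ^ d * (X.ncard : ℝ)

/-- The topology on the group of characters `G → S¹` of the discrete group `G`, as the (compact)
dual group of `G`: for discrete `G` it is the topology of pointwise convergence. -/
@[reducible]
noncomputable def dualTopology (G : Type*) [AddCommGroup G] : TopologicalSpace (AddChar G Circle) :=
  TopologicalSpace.induced (fun (γ : AddChar G Circle) (x : G) => γ x) Pi.topologicalSpace

/-- `Γ` is a neighbourhood (of the trivial character) in the dual group of `G`. -/
def IsCharNhd {G : Type*} [AddCommGroup G] (Γ : Set (AddChar G Circle)) : Prop :=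
  Γ ∈ @nhds (AddChar G Circle) (dualTopology G) 1

/-- The Bohr set with frequency set `Γ` and width `δ`. -/
def Bohr {G : Type*} [AddCommGroup G] (Γ : Set (AddChar G Circle)) (δ : ℝ) : Set G :=
  {x | ∀ γ ∈ Γ, ‖(γ x : ℂ) - 1‖ ≤ δ}

end RelGrowth

namespace RelGrowth

open MeasureTheory Finset

/-! ### Characters separate points, and Haar measure on the dual group -/

section Characters

variable {G : Type*} [AddCommGroup G]

/-! Polynomial growth yields some `B = iX` with `|B + X| ≤ (1 + ε/4)|B|`, where `ε = 1/(4(3k+1))`.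
Let `Γ` be the characters within `ε` of `1` on `X - X`. Off `Γ`, near-invariance of `B` under
translation by `X` forces `|1̂_B| ≤ |B|/2` (`norm_charSum_mul_norm_sub_one_le`). Put `F = 1̂_B ^
(r+1)`. If `y` lies in the Bohr set but not in `(r+1)B - (r+1)B`, then `∫ |F|² γ(y) = 0`; yet on `Γ`
the integrand has real part at least `7/8 |F|²`, and off `Γ` the mass of `|F|²` is tiny, while
Cauchy–Schwarz bounds its total mass below. This contradiction is `bohr_subset_nsmul_sub_nsmul`;
Ruzsa's triangle inequality then bounds the difference set. -/

theorem exists_addChar_circle_ne_one {x : G} (hx : x ≠ 0) : ∃ γ : AddChar G Circle, γ x ≠ 1 := by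
  obtain ⟨c, hc⟩ := CharacterModule.exists_character_apply_ne_zero_of_ne_zero hx
  let e : ℚ →+ Additive Circle :=
    { toFun := fun q => Additive.ofMul (Circle.exp (2 * Real.pi * q))
      map_zero' := by simp
      map_add' := fun p q => by
        rw [← ofMul_mul, ← Circle.exp_add]; push_cast; rw [mul_add] }
  have he : ∀ q : ℚ, e q = 0 ↔ q ∈ AddSubgroup.zmultiples (1 : ℚ) := by
    intro q
    change Circle.exp (2 * Real.pi * q) = 1 ↔ _
    rw [Circle.exp_eq_one, AddSubgroup.mem_zmultiples_iff]
    refine exists_congr fun n => ?_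
    have h : (2 * Real.pi * q = n * (2 * Real.pi)) ↔ (q : ℝ) = n := by
      rw [mul_comm (n : ℝ), mul_right_inj' (by positivity)]
    rw [h, zsmul_one, eq_comm]
    exact_mod_cast Iff.rfl
  let f : AddCircle (1 : ℚ) →+ Additive Circle :=
    QuotientAddGroup.lift _ e fun q hq => (he q).2 hq
  have hf : ∀ z, f z = 0 → z = 0 := by
    intro z
    induction z using QuotientAddGroup.induction_on with
    | H q => exact fun hq => (QuotientAddGroup.eq_zero_iff q).2 ((he q).1 hq)
  refine ⟨⟨fun y => (f (c y)).toMul, by simp, fun a b => by simp⟩, fun h => hc (hf _ ?_)⟩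
  exact h

attribute [local instance] dualTopology

theorem continuous_addChar_eval (x : G) : Continuous fun γ : AddChar G Circle => γ x :=
  (continuous_apply x).comp continuous_induced_dom

theorem isTopologicalGroup_dual : IsTopologicalGroup (AddChar G Circle) where
  continuous_mul := continuous_induced_rng.2 <| continuous_pi fun x =>
    ((continuous_addChar_eval x).comp continuous_fst).mul
      ((continuous_addChar_eval x).comp continuous_snd)
  continuous_inv := continuous_induced_rng.2 <| continuous_pi fun x =>
    continuous_addChar_eval (-x)

theorem compactSpace_dual : CompactSpace (AddChar G Circle) := by
  have hind : Topology.IsInducing (fun (γ : AddChar G Circle) (x : G) => γ x) := ⟨rfl⟩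
  rw [← isCompact_univ_iff, hind.isCompact_iff, Set.image_univ]
  refine IsClosed.isCompact ?_
  have : Set.range (fun (γ : AddChar G Circle) (x : G) => γ x) =
      {f | f 0 = 1} ∩ ⋂ (a : G) (b : G), {f | f (a + b) = f a * f b} := by
    ext f
    simp only [Set.mem_range, Set.mem_inter_iff, Set.mem_ofPred_eq, Set.mem_iInter]
    constructor
    · rintro ⟨γ, rfl⟩
      exact ⟨γ.map_zero_eq_one, γ.map_add_eq_mul⟩
    · rintro ⟨h0, h⟩
      exact ⟨⟨f, h0, h⟩, rfl⟩
  rw [this]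
  refine (isClosed_eq (continuous_apply _) continuous_const).inter ?_
  exact isClosed_iInter fun a => isClosed_iInter fun b =>
    isClosed_eq (continuous_apply _) ((continuous_apply a).mul (continuous_apply b))

/-- Averaging over the dual group is a probability measure for which distinct elements of `G`
are orthogonal. -/
theorem exists_dual_probabilityMeasure (G : Type*) [AddCommGroup G] :
    ∃ (_ : MeasurableSpace (AddChar G Circle)) (μ : Measure (AddChar G Circle)),
      IsProbabilityMeasure μ ∧ (∀ f : AddChar G Circle → ℂ, Continuous f → Integrable f μ) ∧
        (∀ f : AddChar G Circle → ℝ, Continuous f → Integrable f μ) ∧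
        ∀ x : G, x ≠ 0 → ∫ γ, (γ x : ℂ) ∂μ = 0 := by
  let : MeasurableSpace (AddChar G Circle) := borel _
  have : BorelSpace (AddChar G Circle) := ⟨rfl⟩
  have := isTopologicalGroup_dual (G := G)
  have := compactSpace_dual (G := G)
  let μ : Measure (AddChar G Circle) := Measure.haarMeasure ⊤
  have hμ : IsProbabilityMeasure μ := ⟨by
    exact Measure.haarMeasure_self (K₀ := (⊤ : TopologicalSpace.PositiveCompacts _))⟩
  refine ⟨inferInstance, μ, hμ, fun f hf => ?_, fun f hf => ?_, fun x hx => ?_⟩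
  · exact hf.integrable_of_hasCompactSupport (HasCompactSupport.of_compactSpace f)
  · exact hf.integrable_of_hasCompactSupport (HasCompactSupport.of_compactSpace f)
  -- Translating by `χ` multiplies the integral by `χ x ≠ 1` and also preserves it, so it vanishes.
  · obtain ⟨χ, hχ⟩ := exists_addChar_circle_ne_one hx
    have h := integral_mul_left_eq_self (μ := μ) (fun γ : AddChar G Circle => (γ x : ℂ)) χ
    simp only [AddChar.mul_apply, Circle.coe_mul] at h
    rw [integral_const_mul] at h
    by_contra hne
    exact hχ (Circle.ext (by simpa using mul_right_cancel₀ hne (h.trans (one_mul _).symm)))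

end Characters

/-! ### Growth of iterated sumsets -/

section Sumsets

variable {G : Type*} [AddCommGroup G] [DecidableEq G]

theorem iterSumset_coe (n : ℕ) (X : Finset G) : iterSumset n (X : Set G) = ↑(n • X) := by
  ext g
  rw [mem_coe, Finset.mem_nsmul]
  constructor
  · rintro ⟨x, hx, rfl⟩
    exact ⟨fun i => ⟨x i, hx i⟩, by rw [List.sum_ofFn]⟩
  · rintro ⟨f, rfl⟩
    exact ⟨fun i => f i, fun i => (f i).2, by rw [List.sum_ofFn]⟩

theorem HasRelPolyGrowth.card_nsmul_le {X : Finset G} {d : ℝ}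
    (h : HasRelPolyGrowth (X : Set G) d) {n : ℕ} (hn : 1 ≤ n) :
    (#(n • X) : ℝ) ≤ (n : ℝ) ^ d * #X := by
  simpa only [iterSumset_coe, Set.ncard_coe_finset] using h n hn

theorem card_le_card_nsmul {X : Finset G} (hX : X.Nonempty) {n : ℕ} (hn : 1 ≤ n) :
    #X ≤ #(n • X) := by
  obtain ⟨m, rfl⟩ := Nat.exists_eq_add_of_le' hn
  rw [succ_nsmul]
  exact card_le_card_add_left hX.nsmul

/-- Otherwise all `m` steps from `X` to `(m+1)X` gain a factor above `1 + η`, which is too much in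
total. -/
theorem exists_card_succ_nsmul_le {X : Finset G} {η : ℝ} (hη : 0 ≤ η) {m : ℕ}
    (hm : 1 ≤ m) (h : (#((m + 1) • X) : ℝ) ≤ (1 + η) ^ m * #X) :
    ∃ i, 1 ≤ i ∧ i ≤ m ∧ (#((i + 1) • X) : ℝ) ≤ (1 + η) * #(i • X) := by
  by_contra! hcon
  have key : ∀ j, j + 1 ≤ m → (1 + η) ^ (j + 1) * #X < (#((j + 2) • X) : ℝ) := by
    intro j
    induction j with
    | zero => intro hj; simpa using hcon 1 le_rfl hj
    | succ j ih =>
      intro hj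
      calc (1 + η) ^ (j + 1 + 1) * #X = (1 + η) * ((1 + η) ^ (j + 1) * #X) := by ring
        _ ≤ (1 + η) * #((j + 2) • X) := by gcongr; exact (ih (by omega)).le
        _ < _ := hcon (j + 2) (by omega) hj
  obtain ⟨j, rfl⟩ := Nat.exists_eq_add_of_le' hm
  exact (key j le_rfl).not_ge h

/-- Ruzsa's triangle inequality gives `|A - A||A| ≤ |2A|²` for `A = nX`, and `|A| ≥ |X|`. -/
theorem card_nsmul_sub_nsmul_le {X : Finset G} (hX : X.Nonempty) {d : ℝ}
    (h : HasRelPolyGrowth (X : Set G) d) {n : ℕ} (hn : 1 ≤ n) :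
    (#(n • X - n • X) : ℝ) ≤ ((2 * n : ℕ) : ℝ) ^ (2 * d) * #X := by
  have hruz := ruzsa_triangle_inequality_sub_add_add (n • X) (n • X) (n • X)
  rw [← two_nsmul, ← mul_nsmul'] at hruz
  have hruz' : (#(n • X - n • X) : ℝ) * #(n • X) ≤ #((2 * n) • X) * #((2 * n) • X) := by
    exact_mod_cast hruz
  have hle : (#X : ℝ) ≤ #(n • X) := by exact_mod_cast card_le_card_nsmul hX hn
  have hpos : (0 : ℝ) < #X := by exact_mod_cast hX.card_pos
  have h2 := h.card_nsmul_le (n := 2 * n) (by omega)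
  refine le_of_mul_le_mul_right ?_ hpos
  calc (#(n • X - n • X) : ℝ) * #X ≤ #(n • X - n • X) * #(n • X) := by gcongr
    _ ≤ #((2 * n) • X) * #((2 * n) • X) := hruz'
    _ ≤ (((2 * n : ℕ) : ℝ) ^ d * #X) * (((2 * n : ℕ) : ℝ) ^ d * #X) := by gcongr
    _ = ((2 * n : ℕ) : ℝ) ^ (2 * d) * #X * #X := by
      rw [two_mul d, Real.rpow_add (by exact_mod_cast (by omega : 0 < 2 * n))]; ring

end Sumsets

/-! ### Choice of the numerical parameters -/

section Parameters

theorem two_pow_le_one_add_inv_pow {q j m : ℕ} (hq : 1 ≤ q) (h : q * j ≤ m) :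
    (2 : ℝ) ^ j ≤ (1 + 1 / (q : ℝ)) ^ m := by
  have hq' : (0 : ℝ) < q := by exact_mod_cast hq
  have h1 : (2 : ℝ) ≤ (1 + 1 / (q : ℝ)) ^ q := by
    have := one_add_mul_le_pow (a := 1 / (q : ℝ)) (by have : 0 ≤ 1 / (q : ℝ) := by positivity
                                                      linarith) q
    rw [mul_one_div_cancel hq'.ne'] at this
    linarith
  calc (2 : ℝ) ^ j ≤ ((1 + 1 / (q : ℝ)) ^ q) ^ j := by gcongr
    _ = (1 + 1 / (q : ℝ)) ^ (q * j) := (pow_mul ..).symm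
    _ ≤ _ := pow_le_pow_right₀ (le_add_of_nonneg_right (by positivity)) h

/-- If `a ≤ 2 ^ e` and `d ≤ n` then `a ^ d ≤ 2 ^ (e * n)`. -/
theorem rpow_le_two_pow {a e n : ℕ} {d : ℝ} (ha : 1 ≤ a) (h : a ≤ 2 ^ e) (hd : d ≤ n) :
    (a : ℝ) ^ d ≤ 2 ^ (e * n) := by
  calc (a : ℝ) ^ d ≤ (a : ℝ) ^ (n : ℝ) :=
        Real.rpow_le_rpow_of_exponent_le (by exact_mod_cast ha) hd
    _ = (a : ℝ) ^ n := Real.rpow_natCast _ _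
    _ ≤ (2 ^ e) ^ n := by gcongr; exact_mod_cast h
    _ = _ := (pow_mul ..).symm

/-- The numerical choices in the proof of the main theorem. -/
theorem exists_parameters {d : ℝ} (hd : 1 ≤ d) :
    ∃ k r m : ℕ, (k : ℝ) ≤ 512 * (d * Real.log (2 + d) ^ 2) ∧ 1 ≤ k ∧ 1 ≤ m ∧
      ((m + 1 : ℕ) : ℝ) ^ d ≤ (1 + 1 / ((16 * (3 * k + 1) : ℕ) : ℝ)) ^ m ∧
      15 * (((r + 1) * m : ℕ) : ℝ) ^ d < 7 * 4 ^ r ∧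
      ((2 * ((r + 1) * m) : ℕ) : ℝ) ^ (2 * d) < 2 ^ k := by
  obtain ⟨n, hn1, hdn, hnd⟩ : ∃ n : ℕ, 1 ≤ n ∧ d ≤ n ∧ (n : ℝ) ≤ 2 * d :=
    ⟨⌈d⌉₊, Nat.ceil_pos.2 (by linarith), Nat.le_ceil d, by
      linarith [Nat.ceil_lt_add_one (show 0 ≤ d by linarith)]⟩
  obtain ⟨s, hs1, hns, hsn⟩ : ∃ s : ℕ, 1 ≤ s ∧ n < 2 ^ s ∧ 2 ^ s ≤ 2 * n :=
    ⟨Nat.log 2 n + 1, by omega, Nat.lt_pow_succ_log_self (by norm_num) n, by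
      rw [pow_succ, mul_comm]
      exact Nat.mul_le_mul_left 2 (Nat.pow_log_le_self 2 (by omega))⟩
  have hss : s < 2 ^ s := Nat.lt_two_pow_self
  have hns1 : 1 ≤ n * s := Nat.mul_pos hn1 hs1
  have hm1 : 1 ≤ 2 ^ (22 * s) := Nat.one_le_two_pow
  have hpow : ∀ a b c : ℕ, a ≤ 2 ^ b → b ≤ c → a ≤ 2 ^ c := fun a b c h1 h2 =>
    h1.trans (Nat.pow_le_pow_right (by norm_num) h2)
  have hprod : 32 * (n * s) * 2 ^ (22 * s) ≤ 2 ^ (29 * s) := by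
    calc 32 * (n * s) * 2 ^ (22 * s) ≤ 2 ^ (5 * s) * (2 ^ s * 2 ^ s) * 2 ^ (22 * s) := by
          gcongr
          exact hpow 32 5 _ (by norm_num) (by omega)
      _ = 2 ^ (29 * s) := by rw [← pow_add, ← pow_add, ← pow_add]; congr 1; ring
  have hr : 32 * (n * s) - 1 + 1 = 32 * (n * s) := by omega
  -- Here `n` is of size `d` and `s` of size `log (2 + d)`. Since `(r+1)m ≤ 2^(29s)`, the last two
  -- bounds compare `29ns + 3` with `2r = 64ns - 2`, and `60ns` with `k = 64ns`.
  refine ⟨64 * (n * s), 32 * (n * s) - 1, 2 ^ (22 * s), ?_, by omega, hm1, ?_, ?_, ?_⟩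
  · have hlog : (1 : ℝ) ≤ Real.log (2 + d) := by
      rw [Real.le_log_iff_exp_le (by linarith)]
      linarith [Real.exp_one_lt_d9]
    have hs4 : (s : ℝ) ≤ 4 * Real.log (2 + d) := by
      have h1 : (2 : ℝ) ^ s ≤ (2 + d) ^ 2 := by
        have : (2 : ℝ) ^ s ≤ 2 * n := by exact_mod_cast hsn
        nlinarith
      have h2 := Real.log_le_log (by positivity) h1
      rw [Real.log_pow, Real.log_pow] at h2
      have h3 := Real.log_two_gt_d9
      have h4 : (0 : ℝ) ≤ s := by positivity
      push_cast at h2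
      nlinarith
    push_cast
    calc 64 * ((n : ℝ) * s) ≤ 64 * (2 * d * (4 * Real.log (2 + d))) := by gcongr
      _ = 512 * (d * Real.log (2 + d)) := by ring
      _ ≤ _ := by
        gcongr
        nlinarith
  · refine (rpow_le_two_pow (e := 23 * s) (by omega) ?_ hdn).trans
      (two_pow_le_one_add_inv_pow (by omega) ?_)
    · calc 2 ^ (22 * s) + 1 ≤ 2 ^ (22 * s) * 2 := by omega
        _ = 2 ^ (22 * s + 1) := (pow_succ ..).symm
        _ ≤ _ := Nat.pow_le_pow_right (by norm_num) (by omega)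
    · have h4 : (n * s) * (n * s) ≤ 2 ^ (4 * s) := by
        calc (n * s) * (n * s) ≤ (2 ^ s * 2 ^ s) * (2 ^ s * 2 ^ s) := by gcongr
          _ = _ := by rw [← pow_add, ← pow_add]; congr 1; ring
      have h18 : 94208 ≤ 2 ^ (18 * s) := hpow _ 18 _ (by norm_num) (by omega)
      calc 16 * (3 * (64 * (n * s)) + 1) * (23 * s * n)
            ≤ 16 * (256 * (n * s)) * (23 * s * n) := by gcongr; omega
        _ = 94208 * ((n * s) * (n * s)) := by ring
        _ ≤ 2 ^ (18 * s) * 2 ^ (4 * s) := by gcongr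
        _ = _ := by rw [← pow_add]; congr 1; ring
  · rw [hr]
    have h := rpow_le_two_pow (e := 29 * s) (Nat.mul_pos (by omega) hm1) hprod hdn
    have h2 : (2 : ℝ) ^ (29 * s * n) * 8 ≤ 4 ^ (32 * (n * s) - 1) := by
      rw [show (4 : ℝ) = 2 ^ 2 by norm_num, show (8 : ℝ) = 2 ^ 3 by norm_num, ← pow_mul, ← pow_add]
      refine pow_le_pow_right₀ (by norm_num) ?_
      rw [show 29 * s * n = 29 * (n * s) by ring]
      omega
    have h3 : (0 : ℝ) < 2 ^ (29 * s * n) := by positivity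
    linarith
  · rw [hr]
    have h := rpow_le_two_pow (e := 30 * s) (n := 2 * n) (d := 2 * d)
      (a := 2 * (32 * (n * s) * 2 ^ (22 * s))) (by
        have := Nat.mul_pos (show 0 < 32 * (n * s) by omega) hm1
        omega) (by
        calc 2 * (32 * (n * s) * 2 ^ (22 * s)) ≤ 2 * 2 ^ (29 * s) := by gcongr
          _ = 2 ^ (29 * s + 1) := by rw [pow_succ, mul_comm]
          _ ≤ _ := Nat.pow_le_pow_right (by norm_num) (by omega))
      (by push_cast; linarith)
    refine h.trans_lt (pow_lt_pow_right₀ (by norm_num) ?_)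
    rw [show 30 * s * (2 * n) = 60 * (n * s) by ring]
    omega

end Parameters

/-! ### Fourier analysis and the large spectrum -/

section Fourier

variable {G : Type*} [AddCommGroup G]

attribute [local instance] dualTopology

theorem continuous_addChar_coe_eval (x : G) :
    Continuous fun γ : AddChar G Circle => (γ x : ℂ) :=
  continuous_induced_dom.comp (continuous_addChar_eval x)

/-- The trigonometric polynomial on the dual group with coefficients `c` on `S`. -/
noncomputable def trigPoly (S : Finset G) (c : G → ℂ) (γ : AddChar G Circle) : ℂ :=
  ∑ g ∈ S, c g * (γ g : ℂ)

theorem continuous_trigPoly (S : Finset G) (c : G → ℂ) : Continuous (trigPoly S c) :=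
  continuous_finsetSum _ fun g _ =>
    continuous_const.mul (continuous_addChar_coe_eval g)

theorem trigPoly_one (S : Finset G) (c : G → ℂ) : trigPoly S c 1 = ∑ g ∈ S, c g := by
  simp [trigPoly]

theorem exists_trigPoly_mul [DecidableEq G] (S T : Finset G) (c e : G → ℂ) :
    ∃ f : G → ℂ, ∀ γ, trigPoly (S + T) f γ = trigPoly S c γ * trigPoly T e γ := by
  refine ⟨fun h => ∑ p ∈ S ×ˢ T with p.1 + p.2 = h, c p.1 * e p.2, fun γ => ?_⟩
  rw [trigPoly, trigPoly, trigPoly, sum_mul_sum, ← sum_product',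
    ← sum_fiberwise_of_maps_to (s := S ×ˢ T) (t := S + T) (g := fun p => p.1 + p.2)
      fun p hp => add_mem_add (mem_product.1 hp).1 (mem_product.1 hp).2]
  refine sum_congr rfl fun h _ => ?_
  rw [sum_mul]
  refine sum_congr rfl fun p hp => ?_
  rw [← (mem_filter.1 hp).2, AddChar.map_add_eq_mul, Circle.coe_mul]
  ring

theorem exists_trigPoly_pow [DecidableEq G] (S : Finset G) (c : G → ℂ) (r : ℕ) :
    ∃ f : G → ℂ, ∀ γ, trigPoly (r • S) f γ = trigPoly S c γ ^ r := by
  induction r with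
  | zero => exact ⟨1, fun γ => by simp [trigPoly, ← Finset.singleton_zero]⟩
  | succ r ih =>
    obtain ⟨f, hf⟩ := ih
    obtain ⟨e, he⟩ := exists_trigPoly_mul (r • S) S f c
    exact ⟨e, fun γ => by rw [succ_nsmul, he, hf, pow_succ]⟩

theorem addChar_circle_conj (γ : AddChar G Circle) (x : G) :
    (starRingEnd ℂ) (γ x : ℂ) = (γ (-x) : ℂ) := by
  rw [AddChar.map_neg_eq_inv, Circle.coe_inv_eq_conj]

theorem normSq_trigPoly_mul (S : Finset G) (c : G → ℂ) (γ : AddChar G Circle) (y : G) :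
    ((‖trigPoly S c γ‖ ^ 2 : ℝ) : ℂ) * (γ y : ℂ) =
      ∑ g ∈ S, ∑ h ∈ S, c g * (starRingEnd ℂ) (c h) * (γ (g - h + y) : ℂ) := by
  rw [Complex.ofReal_pow, ← Complex.mul_conj', trigPoly, map_sum, sum_mul_sum, sum_mul]
  refine sum_congr rfl fun g _ => ?_
  rw [sum_mul]
  refine sum_congr rfl fun h _ => ?_
  rw [map_mul, addChar_circle_conj, sub_eq_add_neg, AddChar.map_add_eq_mul,
    AddChar.map_add_eq_mul, Circle.coe_mul, Circle.coe_mul]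
  ring

/-- Multiplying the character sum over `B` by `γ w` gives the sum over `B + w`, which omits only `|B
+ X| - |B|` unimodular terms of the sum over `B + X`. Comparing `w = u` with `w = v` costs the
factor 2. -/
theorem norm_charSum_mul_norm_sub_one_le [DecidableEq G] {B X : Finset G} {u v : G} (hu : u ∈ X)
    (hv : v ∈ X) (γ : AddChar G Circle) :
    ‖trigPoly B 1 γ‖ * ‖(γ (u - v) : ℂ) - 1‖ ≤ 2 * ((#(B + X) : ℝ) - #B) := by
  have key : ∀ w ∈ X, ‖trigPoly (B + X) 1 γ - trigPoly B 1 γ * γ w‖ ≤ (#(B + X) : ℝ) - #B := by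
    intro w hw
    have hinj : Set.InjOn (fun b => b + w) (B : Set G) := fun _ _ _ _ h => add_right_cancel h
    have hsub : B.image (fun b => b + w) ⊆ B + X := by
      intro z hz
      obtain ⟨b, hb, rfl⟩ := mem_image.1 hz
      exact add_mem_add hb hw
    have himg : trigPoly B 1 γ * γ w = trigPoly (B.image fun b => b + w) 1 γ := by
      rw [trigPoly, trigPoly, sum_image hinj, sum_mul]
      exact sum_congr rfl fun b _ => by simp [AddChar.map_add_eq_mul]
    rw [himg, trigPoly, trigPoly, ← sum_sdiff hsub, add_sub_cancel_right]
    refine (norm_sum_le _ _).trans ?_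
    have hcard := card_sdiff_add_card_eq_card hsub
    rw [card_image_of_injOn hinj] at hcard
    simp only [Pi.one_apply, one_mul, Circle.norm_coe, sum_const, nsmul_eq_mul, mul_one]
    rw [← hcard]; push_cast; linarith
  have hγ : (γ (u - v) : ℂ) - 1 = ((γ u : ℂ) - γ v) * (γ (-v) : ℂ) := by
    rw [sub_mul, ← Circle.coe_mul, ← Circle.coe_mul, ← AddChar.map_add_eq_mul,
      ← AddChar.map_add_eq_mul, ← sub_eq_add_neg, add_neg_cancel]
    simp
  calc ‖trigPoly B 1 γ‖ * ‖(γ (u - v) : ℂ) - 1‖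
      = ‖trigPoly B 1 γ * γ u - trigPoly B 1 γ * γ v‖ := by
        rw [hγ, norm_mul, Circle.norm_coe, mul_one, ← norm_mul, mul_sub]
    _ = ‖(trigPoly (B + X) 1 γ - trigPoly B 1 γ * γ v) -
          (trigPoly (B + X) 1 γ - trigPoly B 1 γ * γ u)‖ := by congr 1; ring
    _ ≤ _ := (norm_sub_le _ _).trans (by linarith [key u hu, key v hv])

theorem re_ge_of_norm_sub_one_le {z : Circle} (h : ‖(z : ℂ) - 1‖ ≤ 1 / 2) :
    7 / 8 ≤ (z : ℂ).re := by
  have h1 : ‖(z : ℂ) - 1‖ ^ 2 = 2 - 2 * (z : ℂ).re := by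
    have h2 : ‖(z : ℂ)‖ ^ 2 = 1 := by rw [Circle.norm_coe, one_pow]
    rw [← Complex.normSq_eq_norm_sq, Complex.normSq_apply] at h2 ⊢
    simp only [Complex.sub_re, Complex.sub_im, Complex.one_re, Complex.one_im]
    linarith
  nlinarith [norm_nonneg ((z : ℂ) - 1)]

/-- If the large spectrum of `B` lies in `Γ`, then the Bohr set of `Γ` lies in a difference set of
iterated sumsets of `B`, as soon as these do not grow too fast. -/
theorem bohr_subset_nsmul_sub_nsmul [DecidableEq G] {B : Finset G} {Γ : Set (AddChar G Circle)}
    {r : ℕ} (hΓ : ∀ γ ∉ Γ, ‖trigPoly B 1 γ‖ ≤ #B / 2)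
    (hr : (15 * #((r + 1) • B) : ℝ) < 7 * 4 ^ r * #B) :
    Bohr Γ (1 / 2) ⊆ ↑((r + 1) • B - (r + 1) • B) := by
  intro y hy
  by_contra hyB
  obtain ⟨_, μ, _, hintC, hintR, horth⟩ := exists_dual_probabilityMeasure G
  have hint : ∀ (S : Finset G) (c : G → ℂ) (x : G),
      ∫ γ, ((‖trigPoly S c γ‖ ^ 2 : ℝ) : ℂ) * (γ x : ℂ) ∂μ =
        ∑ g ∈ S, ∑ h ∈ S, c g * (starRingEnd ℂ) (c h) * if g - h + x = 0 then 1 else 0 := by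
    intro S c x
    have hc : ∀ g h : G, Continuous fun γ : AddChar G Circle =>
        c g * (starRingEnd ℂ) (c h) * (γ (g - h + x) : ℂ) := fun g h =>
      continuous_const.mul (continuous_addChar_coe_eval _)
    rw [integral_congr_ae (.of_forall fun γ => normSq_trigPoly_mul S c γ x),
      integral_finsetSum _ fun g _ => hintC _ <| continuous_finsetSum _ fun h _ => hc g h]
    refine sum_congr rfl fun g _ => ?_
    rw [integral_finsetSum _ fun h _ => hintC _ (hc g h)]
    refine sum_congr rfl fun h _ => ?_
    rw [integral_const_mul]
    split_ifs with h0
    · simp [h0]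
    · rw [horth _ h0]
  have hparseval : ∀ (S : Finset G) (c : G → ℂ),
      ∫ γ, ‖trigPoly S c γ‖ ^ 2 ∂μ = ∑ g ∈ S, ‖c g‖ ^ 2 := by
    intro S c
    have h := hint S c 0
    simp only [AddChar.map_zero_eq_one, Circle.coe_one, mul_one, add_zero, sub_eq_zero] at h
    rw [integral_complex_ofReal] at h
    apply Complex.ofReal_injective
    rw [h, Complex.ofReal_sum]
    refine sum_congr rfl fun g hg => ?_
    simp [hg, Complex.mul_conj']
  obtain ⟨c, hc⟩ := exists_trigPoly_pow B 1 (r + 1)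
  set S := (r + 1) • B with hS
  -- The frequencies of the integrand are `g - h + y` with `g, h ∈ S`; none is zero, as `y ∉ S - S`.
  have hzero : ∫ γ, ‖trigPoly S c γ‖ ^ 2 * (γ y : ℂ).re ∂μ = 0 := by
    have h := hint S c y
    rw [sum_eq_zero fun g hg => sum_eq_zero fun h hh => ?_] at h
    · have hre := congrArg Complex.re h
      rw [← RCLike.re_eq_complex_re, ← integral_re] at hre
      · simpa [← Complex.ofReal_pow] using hre
      · exact hintC _ ((Complex.continuous_ofReal.comp ((continuous_trigPoly S c).norm.pow 2)).mul
          (continuous_addChar_coe_eval y))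
    · rw [if_neg, mul_zero]
      intro h0
      refine hyB (mem_coe.2 (mem_sub.2 ⟨h, hh, g, hg, ?_⟩))
      rw [← sub_eq_zero, ← neg_eq_zero, ← h0]; abel
  -- Off `Γ` only `Re γ(y) ≥ -1` is available; `15/8 = 7/8 + 1` pays for the loss.
  have hpt : ∀ γ : AddChar G Circle,
      7 / 8 * ‖trigPoly S c γ‖ ^ 2 - 15 / 8 * (((#B : ℝ) / 2) ^ (2 * r) * ‖trigPoly B 1 γ‖ ^ 2) ≤
        ‖trigPoly S c γ‖ ^ 2 * (γ y : ℂ).re := by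
    intro γ
    by_cases hγ : γ ∈ Γ
    · have h1 := re_ge_of_norm_sub_one_le (hy γ hγ)
      have h2 : 0 ≤ ((#B : ℝ) / 2) ^ (2 * r) * ‖trigPoly B 1 γ‖ ^ 2 := by positivity
      nlinarith [sq_nonneg ‖trigPoly S c γ‖]
    · have h1 : -1 ≤ (γ y : ℂ).re := by
        have := Complex.abs_re_le_norm (γ y : ℂ)
        rw [Circle.norm_coe] at this
        exact (abs_le.1 this).1
      have h2 : ‖trigPoly S c γ‖ ^ 2 ≤ ((#B : ℝ) / 2) ^ (2 * r) * ‖trigPoly B 1 γ‖ ^ 2 := by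
        rw [hc, norm_pow, ← pow_mul, show (r + 1) * 2 = 2 * r + 2 by ring, pow_add]
        gcongr
        exact hΓ γ hγ
      nlinarith [sq_nonneg ‖trigPoly S c γ‖]
  have hle := integral_mono (μ := μ) (hintR _ ?_) (hintR _ ?_) hpt
  · rw [hzero, integral_sub (hintR _ ?_) (hintR _ ?_), integral_const_mul, integral_const_mul,
      integral_const_mul, hparseval, hparseval] at hle
    · have hsum : ‖∑ g ∈ S, c g‖ = (#B : ℝ) ^ (r + 1) := by
        rw [← trigPoly_one, hc, trigPoly_one]; simp
      -- Cauchy–Schwarz on the support `S`, the coefficients having sum `F(1) = |B|^(r+1)`: this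
      -- bounds `∫ |F|²` below.
      have hcs : ((#B : ℝ) ^ (r + 1)) ^ 2 ≤ #S * ∑ g ∈ S, ‖c g‖ ^ 2 := by
        rw [← hsum]
        refine le_trans ?_ sq_sum_le_card_mul_sum_sq
        gcongr
        exact norm_sum_le _ _
      have hB : (0 : ℝ) < #B := by
        rcases (Nat.cast_nonneg (α := ℝ) #B).lt_or_eq with h | h
        · exact h
        · rw [← h] at hr
          have : (0 : ℝ) ≤ #S := by positivity
          linarith
      have hone : ∑ g ∈ B, ‖(1 : G → ℂ) g‖ ^ 2 = (#B : ℝ) := by simp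
      rw [hone] at hle
      have h4 : ((#B : ℝ) / 2) ^ (2 * r) * 4 ^ r = (#B : ℝ) ^ (2 * r) := by
        rw [show (4 : ℝ) ^ r = 2 ^ (2 * r) by rw [pow_mul]; norm_num, ← mul_pow]
        norm_num
      have hQ : (0 : ℝ) < ((#B : ℝ) / 2) ^ (2 * r) := by positivity
      set Q := ((#B : ℝ) / 2) ^ (2 * r)
      have h1 : 7 * (Q * 4 ^ r * (#B : ℝ) ^ 2) ≤ 15 * #S * (Q * #B) := by
        calc 7 * (Q * 4 ^ r * (#B : ℝ) ^ 2) = 7 * ((#B : ℝ) ^ (r + 1)) ^ 2 := by rw [h4]; ring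
          _ ≤ #S * (7 * ∑ g ∈ S, ‖c g‖ ^ 2) := by linarith
          _ ≤ #S * (15 * (Q * #B)) := mul_le_mul_of_nonneg_left (by linarith) (by positivity)
          _ = _ := by ring
      have h2 := mul_lt_mul_of_pos_right hr (mul_pos hQ hB)
      nlinarith
    all_goals
      have := continuous_trigPoly S c
      have := continuous_trigPoly B 1
      fun_prop
  · have := continuous_trigPoly S c
    have := continuous_trigPoly B 1
    fun_prop
  · exact ((continuous_trigPoly S c).norm.pow 2).mul
      (Complex.continuous_re.comp (continuous_addChar_coe_eval y))

theorem isCharNhd_of_finite {T : Set G} (hT : T.Finite) {ε : ℝ} (hε : 0 < ε) :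
    IsCharNhd {γ : AddChar G Circle | ∀ x ∈ T, ‖(γ x : ℂ) - 1‖ ≤ ε} := by
  have : ∀ x ∈ T, ∀ᶠ γ in nhds (1 : AddChar G Circle), ‖(γ x : ℂ) - 1‖ ≤ ε := by
    intro x _
    have hcont : Continuous fun γ : AddChar G Circle => ‖(γ x : ℂ) - 1‖ :=
      ((continuous_addChar_coe_eval x).sub continuous_const).norm
    exact (hcont.tendsto 1).eventually_le_const (by simpa using hε)
  exact (Set.Finite.eventually_all hT).2 this

end Fourier

end RelGrowth

/-! ### Assembly of the main theorem -/

open RelGrowth Finset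

theorem mainTheorem8 :
    ∃ C : ℝ, 0 < C ∧
      ∀ (G : Type*) [AddCommGroup G] (X : Set G) (d : ℝ),
        X.Finite → X.Nonempty → 1 ≤ d → RelGrowth.HasRelPolyGrowth X d →
        ∃ (Γ : Set (AddChar G Circle)) (k : ℕ),
          RelGrowth.IsCharNhd Γ ∧
          (k : ℝ) ≤ C * (d * Real.log (2 + d) ^ 2) ∧
          X - X ⊆ RelGrowth.Bohr Γ (1 / (4 * (3 * (k : ℝ) + 1))) ∧
          (RelGrowth.Bohr Γ (1 / 2)).Finite ∧
          ((RelGrowth.Bohr Γ (1 / 2)).ncard : ℝ) < 2 ^ k * (X.ncard : ℝ) := by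
  classical
  refine ⟨512, by norm_num, fun G _ X d hfin hne hd hX => ?_⟩
  lift X to Finset G using hfin
  have hne : X.Nonempty := by simpa using hne
  have hXpos : (0 : ℝ) < #X := by exact_mod_cast hne.card_pos
  obtain ⟨k, r, m, hk, hk1, hm, hgrow, hmass, hcard⟩ := exists_parameters hd
  have hε : (0 : ℝ) < 1 / (4 * (3 * (k : ℝ) + 1)) := by positivity
  set ε : ℝ := 1 / (4 * (3 * (k : ℝ) + 1)) with hεdef
  have hη : 1 / ((16 * (3 * k + 1) : ℕ) : ℝ) = ε / 4 := by
    rw [hεdef]; push_cast; field_simp; norm_num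
  rw [hη] at hgrow
  obtain ⟨i, hi1, him, hi⟩ := exists_card_succ_nsmul_le (X := X) (η := ε / 4) (by positivity) hm
    ((hX.card_nsmul_le (by omega)).trans (by gcongr))
  let Γ : Set (AddChar G Circle) :=
    {γ | ∀ x ∈ (X : Set G) - (X : Set G), ‖(γ x : ℂ) - 1‖ ≤ ε}
  have hspec : ∀ γ ∉ Γ, ‖trigPoly (i • X) 1 γ‖ ≤ (#(i • X) : ℝ) / 2 := by
    intro γ hγ
    simp only [Γ, Set.mem_ofPred_eq, not_forall, not_le] at hγ
    obtain ⟨x, hx, hlt⟩ := hγ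
    obtain ⟨u, hu, v, hv, rfl⟩ := Set.mem_sub.1 hx
    have h := norm_charSum_mul_norm_sub_one_le (B := i • X) (mem_coe.1 hu) (mem_coe.1 hv) γ
    rw [← succ_nsmul] at h
    have h2 : ‖trigPoly (i • X) 1 γ‖ * ε ≤ ‖trigPoly (i • X) 1 γ‖ * ‖(γ (u - v) : ℂ) - 1‖ := by
      gcongr
    -- The growth step bounds the product by `2 · (ε/4)|B|`, and dividing by `ε` leaves `|B|/2`.
    refine le_of_mul_le_mul_right ?_ hε
    linarith
  have hri : 1 ≤ (r + 1) * i := Nat.mul_pos (by omega) hi1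
  have hrim : (r + 1) * i ≤ (r + 1) * m := Nat.mul_le_mul_left _ him
  have hmul : (r + 1) • i • X = ((r + 1) * i) • X := (mul_nsmul' X _ _).symm
  have hcount : (15 * #((r + 1) • i • X) : ℝ) < 7 * 4 ^ r * #(i • X) := by
    rw [hmul]
    have h1 : (#X : ℝ) ≤ #(i • X) := by exact_mod_cast card_le_card_nsmul hne hi1
    calc (15 * #(((r + 1) * i) • X) : ℝ)
        ≤ 15 * ((((r + 1) * i : ℕ) : ℝ) ^ d * #X) := by gcongr; exact hX.card_nsmul_le hri
      _ ≤ 15 * ((((r + 1) * m : ℕ) : ℝ) ^ d * #X) := by gcongr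
      _ = 15 * (((r + 1) * m : ℕ) : ℝ) ^ d * #X := by ring
      _ < 7 * 4 ^ r * #X := by gcongr
      _ ≤ _ := by gcongr
  have hsub := bohr_subset_nsmul_sub_nsmul hspec hcount
  rw [hmul] at hsub
  refine ⟨Γ, k, isCharNhd_of_finite (X.finite_toSet.sub X.finite_toSet) hε, hk,
    fun x hx γ hγ => hγ x hx, (finite_toSet _).subset hsub, ?_⟩
  rw [Set.ncard_coe_finset]
  have hncard : ((Bohr Γ (1 / 2)).ncard : ℝ) ≤ #(((r + 1) * i) • X - ((r + 1) * i) • X) := by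
    have := Set.ncard_le_ncard hsub (finite_toSet _)
    rw [Set.ncard_coe_finset] at this
    exact_mod_cast this
  calc ((Bohr Γ (1 / 2)).ncard : ℝ) ≤ _ := hncard
    _ ≤ ((2 * ((r + 1) * i) : ℕ) : ℝ) ^ (2 * d) * #X := card_nsmul_sub_nsmul_le hne hX hri
    _ ≤ ((2 * ((r + 1) * m) : ℕ) : ℝ) ^ (2 * d) * #X := by gcongr
    _ < _ := by gcongr
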